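/- Let $X$ (source) and $Z$ (noise) be independent real random variables with mean zero and finite, nonzero variances. Scale them to vary the SNR: for each $\gamma>0$ let $s_\gamma,t_\gamma\in\mathbb R$ be such that the source $X_\gamma=s_\gamma X$ and the noise $Z_\gamma=t_\gamma Z$ satisfy $\mathbb E[X_\gamma^2]/\mathbb E[Z_\gamma^2]=\gamma$ (for instance, one of $X,Z$ is kept fixed and the other is scaled). Let $Y_\gamma=X_\gamma+Z_\gamma$, and call a measurable $h$ MSE-optimal at SNR $\gamma$ if it minimizes $\mathbb E[(X_\gamma-h(Y_\gamma))^2]$ among all measurable functions. Put $k_\gamma=\gamma/(\gamma+1)$, the coefficient of the optimal linear estimator. (i) If $Z$ is Gaussian, then for every $\gamma>0$ there is a continuous MSE-optimal estimator $h_\gamma$, every other MSE-optimal estimator equals it almost everywhere with respect to the law of $Y_\gamma$, and, writing $h_\gamma(y)=k_\gamma\,(y+\xi_\gamma(y))$ and $\sigma_\gamma=\sqrt{\mathbb E[Z_\gamma^2]}$, we have $\xi_\gamma(\sigma_\gamma u)/\sigma_\gamma\to 0$ as $\gamma\to 0^+$ for every $u\in\mathbb R$. In particular, if the Gaussian noise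 is kept fixed and the source is scaled, then $\xi_\gamma(y)\to 0$ for every $y\in\mathbb R$. (ii) If $X$ is Gaussian, then for every $\gamma>0$ there is a continuous MSE-optimal estimator $h_\gamma$, every other MSE-optimal estimator equals it almost everywhere with respect to the law of $Y_\gamma$, and, writing $h_\gamma(y)=k_\gamma\,(y+\xi_\gamma(y))$ and $\sigma_\gamma=\sqrt{\mathbb E[X_\gamma^2]}$, we have $\xi_\gamma(\sigma_\gamma u)/\sigma_\gamma\to 0$, and even $\gamma\,\xi_\gamma(\sigma_\gamma u)/\sigma_\gamma\to 0$, as $\gamma\to\infty$ for every $u\in\mathbb R$. In particular, if the Gaussian source is kept fixed and the noise is scaled, then $\xi_\gamma(y)\to 0$ for every $y\in\mathbb R$. -/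

import Mathlib

open MeasureTheory ProbabilityTheory Filter Topology

noncomputable section

/-- Root mean square `√(E[W²])` (the standard deviation, for a centred random variable). -/
def rms {Ω : Type*} [MeasurableSpace Ω] (μ : Measure Ω) (W : Ω → ℝ) : ℝ :=
  Real.sqrt (∫ ω, (W ω) ^ 2 ∂μ)

/-- The signal to noise ratio `E[S²] / E[N²]` of a centred source `S` and a centred noise `N`. -/
def snr {Ω : Type*} [MeasurableSpace Ω] (μ : Measure Ω) (S N : Ω → ℝ) : ℝ :=
  (∫ ω, (S ω) ^ 2 ∂μ) / (∫ ω, (N ω) ^ 2 ∂μ)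

/-- `h` is an MSE-optimal estimator of `S` from the observation `Y`: it minimizes
`E[(S - g(Y))²]` among all measurable functions `g`. -/
def IsMSEOptimal {Ω : Type*} [MeasurableSpace Ω] (μ : Measure Ω) (S Y : Ω → ℝ)
    (h : ℝ → ℝ) : Prop :=
  Measurable h ∧ ∀ g : ℝ → ℝ, Measurable g →
    ∫⁻ ω, ENNReal.ofReal ((S ω - h (Y ω)) ^ 2) ∂μ ≤
      ∫⁻ ω, ENNReal.ofReal ((S ω - g (Y ω)) ^ 2) ∂μ

/-- `h` is the continuous version of the MSE-optimal estimator: it is continuous, it is optimal, and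
every optimal estimator agrees with it almost everywhere with respect to the law of `Y`. -/
def IsContinuousMSEEstimator {Ω : Type*} [MeasurableSpace Ω] (μ : Measure Ω) (S Y : Ω → ℝ)
    (h : ℝ → ℝ) : Prop :=
  Continuous h ∧ IsMSEOptimal μ S Y h ∧
    ∀ g : ℝ → ℝ, IsMSEOptimal μ S Y g → g =ᵐ[μ.map Y] h

/-- The coefficient `k = γ / (γ + 1)` of the optimal linear estimator at signal to noise
ratio `γ`. -/
def linCoeff (γ : ℝ) : ℝ := γ / (γ + 1)

/-- The nonlinear part `ξ` of an estimator `h` at signal to noise ratio `γ`, determined (for `γ > 0`)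
by `h y = k * (y + ξ y)` with `k = γ / (γ + 1)`. -/
def nonlinPart (γ : ℝ) (h : ℝ → ℝ) (y : ℝ) : ℝ := h y / linCoeff γ - y

/-- A family of estimators `h γ`, indexed by the signal to noise ratio, is asymptotically linear
along `l`: the nonlinear part `ξ` tends to `0` pointwise, where observations are
measured in units of `σ γ`. For constant `σ = 1` it says that `ξ` tends to `0` at every `y`. -/
def AsymptoticallyLinear (l : Filter ℝ) (σ : ℝ → ℝ) (h : ℝ → ℝ → ℝ) : Prop :=
  ∀ u : ℝ, Tendsto (fun γ => nonlinPart γ (h γ) (σ γ * u) / σ γ) l (𝓝 0)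

end

/-! The mean-square minimizer is the conditional mean. Under Gaussian noise, Bayes' formula gives it
as a quotient of Gaussian-weighted integrals over the source law, which is continuous in `y`
(`isContinuousMSEEstimator_gaussianEstimator`). In units of the noise deviation `σ`, and with `c = s
/ σ`, it becomes `G c = E[c X e^(-(u - cX)²/2)] / E[e^(-(u - cX)²/2)]`, while `γ = c² E[X²]`. Since
`E[X] = 0`, the numerator is of second order in `c`, and one differentiation under the integral,
dominated by `X²`, yields `G c / γ → u` (`tendsto_gaussian_ratio_div_sq`). So second moments
suffice, and (i) follows from `ξ / σ = (γ + 1) (G / γ) - u`.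

For (ii), exchange source and noise: estimating one summand of `Y` is the same problem as estimating
the other (`IsContinuousMSEEstimator.sub_of_add`), now at ratio `γ⁻¹ → 0`. Subtracting from `y`
leaves `γ ξ / σ = u - (1 + γ⁻¹) (γ G)`, which explains the extra factor `γ`. -/

/-! ### Conditional means as least-squares estimators. -/

section CondExp

variable {Ω : Type*} {mΩ : MeasurableSpace Ω} {μ : Measure Ω} {S Y : Ω → ℝ} {h g : ℝ → ℝ}

/-- Pythagoras: `h(Y) - g(Y)` is a function of `Y`, so it pulls out of the conditional expectation
and the cross term vanishes. -/
lemma integral_sub_sq_eq_of_ae_eq_condExp [IsProbabilityMeasure μ] (hS : MemLp S 2 μ)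
    (hY : Measurable Y) (hh : Measurable h) (hg : Measurable g)
    (hc : (fun ω => h (Y ω)) =ᵐ[μ] μ[S | MeasurableSpace.comap Y inferInstance])
    (hgY : MemLp (fun ω => g (Y ω)) 2 μ) :
    ∫ ω, (S ω - g (Y ω)) ^ 2 ∂μ =
      ∫ ω, (S ω - h (Y ω)) ^ 2 ∂μ + ∫ ω, (h (Y ω) - g (Y ω)) ^ 2 ∂μ := by
  have hhY : MemLp (fun ω => h (Y ω)) 2 μ := (hS.condExp one_le_two).ae_eq hc.symm
  have hd : MemLp (fun ω => h (Y ω) - g (Y ω)) 2 μ := hhY.sub hgY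
  have hSd : Integrable (fun ω => S ω * (h (Y ω) - g (Y ω))) μ := hS.integrable_mul hd
  have hhd : Integrable (fun ω => h (Y ω) * (h (Y ω) - g (Y ω))) μ := hhY.integrable_mul hd
  have hdm : StronglyMeasurable[MeasurableSpace.comap Y inferInstance]
      (fun ω => h (Y ω) - g (Y ω)) :=
    ((hh.sub hg).comp (comap_measurable Y)).stronglyMeasurable
  have key : ∫ ω, S ω * (h (Y ω) - g (Y ω)) ∂μ = ∫ ω, h (Y ω) * (h (Y ω) - g (Y ω)) ∂μ := by
    rw [← integral_condExp hY.comap_le]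
    refine integral_congr_ae ?_
    filter_upwards [condExp_mul_of_stronglyMeasurable_right hdm hSd
      (hS.integrable one_le_two), hc] with ω h1 h2
    have h1' : μ[fun ω => S ω * (h (Y ω) - g (Y ω)) | MeasurableSpace.comap Y inferInstance] ω =
        μ[S | MeasurableSpace.comap Y inferInstance] ω * (h (Y ω) - g (Y ω)) := h1
    rw [h1', ← h2]
  have h1 : Integrable (fun ω => (S ω - h (Y ω)) ^ 2) μ := (hS.sub hhY).integrable_sq
  have h2 : Integrable (fun ω => (h (Y ω) - g (Y ω)) ^ 2) μ := hd.integrable_sq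
  have h3 : ∀ ω, (S ω - g (Y ω)) ^ 2 = ((S ω - h (Y ω)) ^ 2 + (h (Y ω) - g (Y ω)) ^ 2) +
      2 * (S ω * (h (Y ω) - g (Y ω)) - h (Y ω) * (h (Y ω) - g (Y ω))) := fun ω => by ring
  simp_rw [h3]
  rw [integral_add (by exact h1.add h2) (by exact (hSd.sub hhd).const_mul 2), integral_add h1 h2,
    integral_const_mul, integral_sub hSd hhd, key]
  ring

lemma MeasureTheory.MemLp.of_lintegral_ofReal_sq_ne_top {f : Ω → ℝ}
    (hf : AEStronglyMeasurable f μ) (h : ∫⁻ ω, ENNReal.ofReal (f ω ^ 2) ∂μ ≠ ⊤) :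
    MemLp f 2 μ := by
  rw [memLp_two_iff_integrable_sq hf]
  exact ⟨hf.pow 2, (hasFiniteIntegral_iff_ofReal (ae_of_all _ fun ω => sq_nonneg _)).2
    (lt_top_iff_ne_top.2 h)⟩

lemma MeasureTheory.MemLp.lintegral_ofReal_sq {f : Ω → ℝ} (hf : MemLp f 2 μ) :
    ∫⁻ ω, ENNReal.ofReal (f ω ^ 2) ∂μ = ENNReal.ofReal (∫ ω, f ω ^ 2 ∂μ) :=
  (ofReal_integral_eq_lintegral_ofReal hf.integrable_sq (ae_of_all _ fun _ => sq_nonneg _)).symm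

/-- Writing `g(Y) = S - (S - g(Y))` shows that competitors outside L² have infinite cost, so
Pythagoras covers all the others. -/
lemma memLp_comp_of_lintegral_ne_top (hS : MemLp S 2 μ) (hY : Measurable Y) (hg : Measurable g)
    (htop : ∫⁻ ω, ENNReal.ofReal ((S ω - g (Y ω)) ^ 2) ∂μ ≠ ⊤) :
    MemLp (fun ω => g (Y ω)) 2 μ := by
  have hm : AEStronglyMeasurable (fun ω => g (Y ω)) μ := (hg.comp hY).aestronglyMeasurable
  have h1 : MemLp (fun ω => S ω - g (Y ω)) 2 μ :=
    .of_lintegral_ofReal_sq_ne_top (hS.aestronglyMeasurable.sub hm) htop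
  exact (hS.sub h1).ae_eq (ae_of_all _ fun ω => by simp)

lemma isMSEOptimal_of_ae_eq_condExp [IsProbabilityMeasure μ] (hS : MemLp S 2 μ)
    (hY : Measurable Y) (hh : Measurable h)
    (hc : (fun ω => h (Y ω)) =ᵐ[μ] μ[S | MeasurableSpace.comap Y inferInstance]) :
    IsMSEOptimal μ S Y h := by
  refine ⟨hh, fun g hg => ?_⟩
  by_cases htop : ∫⁻ ω, ENNReal.ofReal ((S ω - g (Y ω)) ^ 2) ∂μ = ⊤
  · rw [htop]; exact le_top
  have hgY := memLp_comp_of_lintegral_ne_top hS hY hg htop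
  have hhY : MemLp (fun ω => h (Y ω)) 2 μ := (hS.condExp one_le_two).ae_eq hc.symm
  have hgval := (hS.sub hgY).lintegral_ofReal_sq
  have hhval := (hS.sub hhY).lintegral_ofReal_sq
  simp only [Pi.sub_apply] at hgval hhval
  rw [hgval, hhval]
  refine ENNReal.ofReal_le_ofReal ?_
  have := integral_sub_sq_eq_of_ae_eq_condExp hS hY hh hg hc hgY
  have h0 : 0 ≤ ∫ ω, (h (Y ω) - g (Y ω)) ^ 2 ∂μ := integral_nonneg fun _ => sq_nonneg _
  linarith

lemma IsMSEOptimal.ae_eq_of_ae_eq_condExp [IsProbabilityMeasure μ] (hS : MemLp S 2 μ)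
    (hY : Measurable Y) (hh : Measurable h)
    (hc : (fun ω => h (Y ω)) =ᵐ[μ] μ[S | MeasurableSpace.comap Y inferInstance])
    (hg : IsMSEOptimal μ S Y g) : g =ᵐ[μ.map Y] h := by
  have hhY : MemLp (fun ω => h (Y ω)) 2 μ := (hS.condExp one_le_two).ae_eq hc.symm
  have hle := hg.2 h hh
  have hhval := (hS.sub hhY).lintegral_ofReal_sq
  simp only [Pi.sub_apply] at hhval
  have htop : ∫⁻ ω, ENNReal.ofReal ((S ω - g (Y ω)) ^ 2) ∂μ ≠ ⊤ :=
    ne_top_of_le_ne_top (by rw [hhval]; exact ENNReal.ofReal_ne_top) hle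
  have hgY := memLp_comp_of_lintegral_ne_top hS hY hg.1 htop
  have hgval := (hS.sub hgY).lintegral_ofReal_sq
  simp only [Pi.sub_apply] at hgval
  rw [hhval, hgval, ENNReal.ofReal_le_ofReal_iff (integral_nonneg fun _ => sq_nonneg _),
    integral_sub_sq_eq_of_ae_eq_condExp hS hY hh hg.1 hc hgY] at hle
  have h0 : ∫ ω, (h (Y ω) - g (Y ω)) ^ 2 ∂μ = 0 :=
    le_antisymm (by linarith) (integral_nonneg fun _ => sq_nonneg _)
  rw [integral_eq_zero_iff_of_nonneg (fun _ => sq_nonneg _) (by exact (hhY.sub hgY).integrable_sq)] at h0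
  rw [Filter.EventuallyEq, ae_map_iff hY.aemeasurable (measurableSet_eq_fun hg.1 hh)]
  filter_upwards [h0] with ω hω
  have := pow_eq_zero_iff (two_ne_zero) |>.1 hω
  linarith

end CondExp

/-! ### Passing to the joint law, and exchanging source and noise. -/

section Transfer

variable {Ω : Type*} [MeasurableSpace Ω] {μ : Measure Ω} {S N Y : Ω → ℝ} {h : ℝ → ℝ}

/-- Allows working on `ℝ × ℝ`, where the observation is a coordinate and hence measurable, not just
a.e. measurable. -/
lemma isMSEOptimal_map_iff (hS : AEMeasurable S μ) (hY : AEMeasurable Y μ) :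
    IsMSEOptimal (μ.map fun ω => (S ω, Y ω)) Prod.fst Prod.snd h ↔ IsMSEOptimal μ S Y h := by
  refine and_congr_right fun hh => forall₂_congr fun g hg => ?_
  rw [lintegral_map' (by fun_prop) (hS.prodMk hY), lintegral_map' (by fun_prop) (hS.prodMk hY)]

lemma isContinuousMSEEstimator_map_iff (hS : AEMeasurable S μ) (hY : AEMeasurable Y μ) :
    IsContinuousMSEEstimator (μ.map fun ω => (S ω, Y ω)) Prod.fst Prod.snd h ↔
      IsContinuousMSEEstimator μ S Y h := by
  unfold IsContinuousMSEEstimator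
  simp only [isMSEOptimal_map_iff hS hY]
  rw [AEMeasurable.map_map_of_aemeasurable measurable_snd.aemeasurable (hS.prodMk hY)]
  rfl

lemma IsMSEOptimal.sub_of_add (hh : IsMSEOptimal μ S (fun ω => S ω + N ω) h) :
    IsMSEOptimal μ N (fun ω => S ω + N ω) (fun y => y - h y) := by
  refine ⟨measurable_id.sub hh.1, fun g hg => ?_⟩
  have := hh.2 (fun y => y - g y) (measurable_id.sub hg)
  convert this using 4 with ω ω <;> ring

lemma IsContinuousMSEEstimator.sub_of_add
    (hh : IsContinuousMSEEstimator μ S (fun ω => S ω + N ω) h) :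
    IsContinuousMSEEstimator μ N (fun ω => S ω + N ω) (fun y => y - h y) := by
  refine ⟨continuous_id.sub hh.1, hh.2.1.sub_of_add, fun g hg => ?_⟩
  -- The exchange is an involution: applied to `g` it gives an optimal estimator of `S`, to which
  -- uniqueness applies.
  have hc : (fun ω => S ω + N ω) = fun ω => N ω + S ω := by ext ω; ring
  have hg' := hg
  rw [hc] at hg'
  have := hg'.sub_of_add
  rw [← hc] at this
  filter_upwards [hh.2.2 _ this] with y hy
  linarith

end Transfer

/-- The conditional mean, given that `S + N = y`, of a source `S` of law `P` observed through an
independent centred Gaussian noise `N` of variance `v`. -/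
noncomputable def gaussianEstimator (P : Measure ℝ) (v : NNReal) (y : ℝ) : ℝ :=
  (∫ x, x * gaussianPDFReal x v y ∂P) / ∫ x, gaussianPDFReal x v y ∂P

/-! ### Bayes' formula under Gaussian noise. -/

section Density

variable {P : Measure ℝ} {v : NNReal}

lemma gaussianPDFReal_le (m : ℝ) (v : NNReal) (x : ℝ) :
    gaussianPDFReal m v x ≤ (√(2 * Real.pi * v))⁻¹ := by
  rw [gaussianPDFReal]
  refine mul_le_of_le_one_right (by positivity) (Real.exp_le_one_iff.2 ?_)
  rw [neg_div]
  exact neg_nonpos.2 (by positivity)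

lemma continuous_gaussianPDFReal (m : ℝ) (v : NNReal) : Continuous (gaussianPDFReal m v) := by
  rw [gaussianPDFReal_def]
  fun_prop

lemma measurable_gaussianPDFReal_mean (v : NNReal) (y : ℝ) :
    Measurable fun m => gaussianPDFReal m v y := by
  unfold gaussianPDFReal
  fun_prop

lemma integrable_gaussianPDFReal_mean [IsFiniteMeasure P] (v : NNReal) (y : ℝ) :
    Integrable (fun x => gaussianPDFReal x v y) P := by
  refine Integrable.of_bound (measurable_gaussianPDFReal_mean v y).aestronglyMeasurable
    (√(2 * Real.pi * v))⁻¹ (ae_of_all _ fun x => ?_)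
  rw [Real.norm_of_nonneg (gaussianPDFReal_nonneg _ _ _)]
  exact gaussianPDFReal_le _ _ _

lemma integral_gaussianPDFReal_mean_pos [IsProbabilityMeasure P] (hv : v ≠ 0) (y : ℝ) :
    0 < ∫ x, gaussianPDFReal x v y ∂P := by
  rw [integral_pos_iff_support_of_nonneg (fun x => gaussianPDFReal_nonneg _ _ _)
    (integrable_gaussianPDFReal_mean v y)]
  have : Function.support (fun x => gaussianPDFReal x v y) = Set.univ := by
    ext x
    simp [(gaussianPDFReal_pos x v y hv).ne']
  simp [this]

lemma continuous_gaussianEstimator [IsProbabilityMeasure P] (hv : v ≠ 0)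
    (hP : Integrable (fun x => x) P) : Continuous (gaussianEstimator P v) := by
  refine Continuous.div ?_ ?_ fun y => (integral_gaussianPDFReal_mean_pos hv y).ne'
  · refine continuous_of_dominated (bound := fun x => |x| * (√(2 * Real.pi * v))⁻¹)
      (fun y => (measurable_id.mul (measurable_gaussianPDFReal_mean v y)).aestronglyMeasurable)
      (fun y => ae_of_all _ fun x => ?_) (hP.abs.mul_const _)
      (ae_of_all _ fun x => continuous_const.mul (continuous_gaussianPDFReal x v))
    rw [norm_mul, Real.norm_of_nonneg (gaussianPDFReal_nonneg x v y), Real.norm_eq_abs]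
    exact mul_le_mul_of_nonneg_left (gaussianPDFReal_le x v y) (abs_nonneg x)
  · refine continuous_of_dominated (bound := fun _ => (√(2 * Real.pi * v))⁻¹)
      (fun y => (measurable_gaussianPDFReal_mean v y).aestronglyMeasurable)
      (fun y => ae_of_all _ fun x => ?_) (integrable_const _)
      (ae_of_all _ fun x => continuous_gaussianPDFReal x v)
    rw [Real.norm_of_nonneg (gaussianPDFReal_nonneg x v y)]
    exact gaussianPDFReal_le x v y

lemma measurable_gaussianPDFReal_prod (v : NNReal) :
    Measurable fun p : ℝ × ℝ => gaussianPDFReal p.1 v p.2 := by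
  unfold gaussianPDFReal
  fun_prop

lemma measurable_gaussianPDF_prod (v : NNReal) :
    Measurable fun p : ℝ × ℝ => gaussianPDF p.1 v p.2 :=
  (measurable_gaussianPDFReal_prod v).ennreal_ofReal

lemma map_prodMk_add_eq_withDensity {Ω : Type*} [MeasurableSpace Ω] {μ : Measure Ω}
    [IsProbabilityMeasure μ] {S N : Ω → ℝ} (hS : AEMeasurable S μ) (hSN : IndepFun S N μ)
    (hN : HasLaw N (gaussianReal 0 v) μ) (hv : v ≠ 0) :
    μ.map (fun ω => (S ω, S ω + N ω)) =
      ((μ.map S).prod volume).withDensity fun p => gaussianPDF p.1 v p.2 := by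
  have hprob : IsProbabilityMeasure (μ.map S) := Measure.isProbabilityMeasure_map hS
  have hF : Measurable fun p : ℝ × ℝ => (p.1, p.1 + p.2) := by fun_prop
  have h1 : μ.map (fun ω => (S ω, S ω + N ω)) =
      ((μ.map S).prod (gaussianReal 0 v)).map fun p => (p.1, p.1 + p.2) := by
    rw [← hN.map_eq, ← (indepFun_iff_map_prod_eq_prod_map_map hS hN.aemeasurable).1 hSN,
      AEMeasurable.map_map_of_aemeasurable hF.aemeasurable (hS.prodMk hN.aemeasurable)]
    rfl
  rw [h1]
  ext B hB
  rw [Measure.map_apply hF hB, Measure.prod_apply (hF hB), withDensity_apply _ hB,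
    ← lintegral_indicator hB,
    lintegral_prod _ ((measurable_gaussianPDF_prod v).indicator hB).aemeasurable]
  refine lintegral_congr fun x => ?_
  have hBx : MeasurableSet (Prod.mk x ⁻¹' B) := measurable_prodMk_left hB
  have h2 : gaussianReal 0 v (Prod.mk x ⁻¹' ((fun p : ℝ × ℝ => (p.1, p.1 + p.2)) ⁻¹' B)) =
      (gaussianReal 0 v).map (x + ·) (Prod.mk x ⁻¹' B) := by
    rw [Measure.map_apply (measurable_const_add x) hBx]
    rfl
  rw [h2, gaussianReal_map_const_add, zero_add, gaussianReal_apply _ hv, ← lintegral_indicator hBx]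
  rfl

lemma integrable_prod_mul_gaussianPDFReal [IsProbabilityMeasure P] (hv : v ≠ 0)
    (hP : Integrable (fun x => x) P) :
    Integrable (fun p : ℝ × ℝ => p.1 * gaussianPDFReal p.1 v p.2) (P.prod volume) := by
  rw [integrable_prod_iff
    (by exact (measurable_fst.mul (measurable_gaussianPDFReal_prod v)).aestronglyMeasurable)]
  refine ⟨ae_of_all _ fun x => (integrable_gaussianPDFReal x v).const_mul x, ?_⟩
  refine hP.abs.congr (ae_of_all _ fun x => ?_)
  simp [norm_mul, abs_of_nonneg (gaussianPDFReal_nonneg _ _ _), integral_const_mul,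
    integral_gaussianPDFReal_eq_one x hv]

lemma gaussianEstimator_mul_integral [IsProbabilityMeasure P] (hv : v ≠ 0) (y : ℝ) :
    ∫ x, gaussianEstimator P v y * gaussianPDFReal x v y ∂P =
      ∫ x, x * gaussianPDFReal x v y ∂P := by
  rw [integral_const_mul, gaussianEstimator,
    div_mul_cancel₀ _ (integral_gaussianPDFReal_mean_pos hv y).ne']

lemma integrable_prod_gaussianEstimator_mul [IsProbabilityMeasure P] (hv : v ≠ 0)
    (hP : Integrable (fun x => x) P) :
    Integrable (fun p : ℝ × ℝ => gaussianEstimator P v p.2 * gaussianPDFReal p.1 v p.2)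
      (P.prod volume) := by
  have hm := (continuous_gaussianEstimator hv hP).measurable
  rw [integrable_prod_iff' (by exact ((hm.comp measurable_snd).mul
    (measurable_gaussianPDFReal_prod v)).aestronglyMeasurable)]
  refine ⟨ae_of_all _ fun y => (integrable_gaussianPDFReal_mean v y).const_mul
    (gaussianEstimator P v y), ?_⟩
  -- Integrating over `x` first cancels the denominator of the estimator and leaves `|∫ x φ|`,
  -- integrable in `y` by Fubini.
  refine ((integrable_prod_mul_gaussianPDFReal hv hP).integral_prod_right).norm.congr
    (ae_of_all _ fun y => ?_)
  dsimp only
  rw [← gaussianEstimator_mul_integral hv y, integral_const_mul, norm_mul,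
    Real.norm_of_nonneg (integral_gaussianPDFReal_mean_pos hv y).le, ← integral_const_mul]
  refine integral_congr_ae (ae_of_all _ fun x => ?_)
  simp [norm_mul, abs_of_nonneg (gaussianPDFReal_nonneg _ _ _)]

/-- Events of the observation are strips `univ ×ˢ A`; with `x` as the inner variable, the two set
integrals agree for each `y` by `gaussianEstimator_mul_integral`. -/
lemma gaussianEstimator_ae_eq_condExp [IsProbabilityMeasure P] (hv : v ≠ 0)
    (hP : Integrable (fun x => x) P)
    (hQ : IsProbabilityMeasure ((P.prod volume).withDensity fun p => gaussianPDF p.1 v p.2)) :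
    (fun p : ℝ × ℝ => gaussianEstimator P v p.2)
      =ᵐ[(P.prod volume).withDensity fun p => gaussianPDF p.1 v p.2]
      ((P.prod volume).withDensity fun p => gaussianPDF p.1 v p.2)[Prod.fst |
        MeasurableSpace.comap Prod.snd inferInstance] := by
  have hm := (continuous_gaussianEstimator hv hP).measurable
  have hd := measurable_gaussianPDF_prod v
  have hlt : ∀ᵐ p ∂P.prod (volume : Measure ℝ), gaussianPDF p.1 v p.2 < ⊤ :=
    ae_of_all _ fun p => gaussianPDF_lt_top
  have h1 := integrable_prod_mul_gaussianPDFReal hv hP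
  have h2 := integrable_prod_gaussianEstimator_mul hv hP
  have hfst : Integrable Prod.fst ((P.prod volume).withDensity fun p => gaussianPDF p.1 v p.2) := by
    rw [integrable_withDensity_iff hd hlt]
    simpa only [toReal_gaussianPDF] using h1
  have hest : Integrable (fun p : ℝ × ℝ => gaussianEstimator P v p.2)
      ((P.prod volume).withDensity fun p => gaussianPDF p.1 v p.2) := by
    rw [integrable_withDensity_iff hd hlt]
    simpa only [toReal_gaussianPDF] using h2
  refine ae_eq_condExp_of_forall_setIntegral_eq measurable_snd.comap_le hfst
    (fun _ _ _ => hest.integrableOn) ?_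
    ((hm.comp (comap_measurable Prod.snd)).aestronglyMeasurable)
  rintro _ ⟨A, hA, rfl⟩ -
  have hA' : MeasurableSet (Prod.snd ⁻¹' A : Set (ℝ × ℝ)) := measurable_snd hA
  rw [setIntegral_withDensity_eq_setIntegral_toReal_smul hd (ae_restrict_of_ae hlt) _ hA',
    setIntegral_withDensity_eq_setIntegral_toReal_smul hd (ae_restrict_of_ae hlt) _ hA']
  have hset : (Prod.snd ⁻¹' A : Set (ℝ × ℝ)) = Set.univ ×ˢ A := by ext; simp
  simp only [toReal_gaussianPDF, smul_eq_mul, hset]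
  simp_rw [mul_comm (gaussianPDFReal _ _ _)]
  rw [← Measure.prod_restrict, Measure.restrict_univ, integral_prod_symm, integral_prod_symm]
  · exact integral_congr_ae (ae_of_all _ fun y => gaussianEstimator_mul_integral hv y)
  · have := h1.restrict (s := Set.univ ×ˢ A)
    rwa [← Measure.prod_restrict, Measure.restrict_univ] at this
  · have := h2.restrict (s := Set.univ ×ˢ A)
    rwa [← Measure.prod_restrict, Measure.restrict_univ] at this

lemma isContinuousMSEEstimator_gaussianEstimator {Ω : Type*} [MeasurableSpace Ω] {μ : Measure Ω}
    [IsProbabilityMeasure μ] {S N : Ω → ℝ} (hS : MemLp S 2 μ) (hSN : IndepFun S N μ)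
    (hN : HasLaw N (gaussianReal 0 v) μ) (hv : v ≠ 0) :
    IsContinuousMSEEstimator μ S (fun ω => S ω + N ω) (gaussianEstimator (μ.map S) v) := by
  have hSm := hS.aestronglyMeasurable.aemeasurable
  have hY : AEMeasurable (fun ω => S ω + N ω) μ := hSm.add hN.aemeasurable
  have hprob : IsProbabilityMeasure (μ.map S) := Measure.isProbabilityMeasure_map hSm
  have hP : Integrable (fun x => x) (μ.map S) :=
    (integrable_map_measure aestronglyMeasurable_id hSm).2 (hS.integrable one_le_two)
  have hcont := continuous_gaussianEstimator hv hP
  have hQ : IsProbabilityMeasure (μ.map fun ω => (S ω, S ω + N ω)) :=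
    Measure.isProbabilityMeasure_map (hSm.prodMk hY)
  have hfst : MemLp Prod.fst 2 (μ.map fun ω => (S ω, S ω + N ω)) :=
    (memLp_map_measure_iff measurable_fst.aestronglyMeasurable (hSm.prodMk hY)).2 hS
  rw [← isContinuousMSEEstimator_map_iff hSm hY]
  have hlaw := map_prodMk_add_eq_withDensity hSm hSN hN hv
  have hc : (fun p : ℝ × ℝ => gaussianEstimator (μ.map S) v p.2)
      =ᵐ[μ.map fun ω => (S ω, S ω + N ω)]
      (μ.map fun ω => (S ω, S ω + N ω))[Prod.fst |
        MeasurableSpace.comap Prod.snd inferInstance] := by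
    rw [hlaw] at hQ ⊢
    exact gaussianEstimator_ae_eq_condExp hv hP hQ
  exact ⟨hcont, isMSEOptimal_of_ae_eq_condExp hfst measurable_snd hcont.measurable hc,
    fun g hg => hg.ae_eq_of_ae_eq_condExp hfst measurable_snd hcont.measurable hc⟩

end Density

/-! ### Asymptotics at small signal to noise ratio. -/

section SmallScale

variable {Ω : Type*} [MeasurableSpace Ω] {μ : Measure Ω} {X Z : Ω → ℝ}

/-- Makes `X²` dominate the `c`-derivative uniformly in `c`. -/
lemma abs_mul_exp_neg_sq_div_two_le_one (w : ℝ) : |w| * Real.exp (-w ^ 2 / 2) ≤ 1 := by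
  rw [neg_div, Real.exp_neg, ← div_eq_mul_inv, div_le_one (Real.exp_pos _)]
  have := Real.add_one_le_exp (w ^ 2 / 2)
  nlinarith [sq_nonneg (|w| - 1), sq_abs w]

lemma exp_neg_sq_div_two_le_one (w : ℝ) : Real.exp (-w ^ 2 / 2) ≤ 1 :=
  Real.exp_le_one_iff.2 (by nlinarith [sq_nonneg w])

lemma hasDerivAt_integral_mul_exp_neg_sq [IsProbabilityMeasure μ] (hX : MemLp X 2 μ) (u : ℝ) :
    HasDerivAt (fun c : ℝ => ∫ ω, X ω * Real.exp (-(u - c * X ω) ^ 2 / 2) ∂μ)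
      ((∫ ω, X ω ^ 2 ∂μ) * (u * Real.exp (-u ^ 2 / 2))) 0 := by
  have hXm := hX.aestronglyMeasurable.aemeasurable
  have hint : Integrable (fun ω => X ω * Real.exp (-(u - 0 * X ω) ^ 2 / 2)) μ := by
    refine (hX.integrable one_le_two).mono (by fun_prop) (ae_of_all _ fun ω => ?_)
    rw [norm_mul, Real.norm_of_nonneg (Real.exp_pos _).le]
    exact mul_le_of_le_one_right (norm_nonneg _) (exp_neg_sq_div_two_le_one _)
  have hbound : ∀ ω, ∀ c : ℝ,
      ‖X ω ^ 2 * ((u - c * X ω) * Real.exp (-(u - c * X ω) ^ 2 / 2))‖ ≤ X ω ^ 2 := fun ω c => by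
    rw [norm_mul, Real.norm_of_nonneg (sq_nonneg _), norm_mul,
      Real.norm_of_nonneg (Real.exp_pos _).le]
    exact mul_le_of_le_one_right (sq_nonneg _) (abs_mul_exp_neg_sq_div_two_le_one _)
  have hderiv : ∀ ω, ∀ c : ℝ, HasDerivAt (fun c : ℝ => X ω * Real.exp (-(u - c * X ω) ^ 2 / 2))
      (X ω ^ 2 * ((u - c * X ω) * Real.exp (-(u - c * X ω) ^ 2 / 2))) c := fun ω c => by
    have h1 : HasDerivAt (fun c : ℝ => u - c * X ω) (-X ω) c := by
      simpa using ((hasDerivAt_id c).mul_const (X ω)).const_sub u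
    have h2 := (((h1.pow 2).neg.div_const 2).exp).const_mul (X ω)
    refine h2.congr_deriv ?_
    simp
    ring
  have h := (hasDerivAt_integral_of_dominated_loc_of_deriv_le (μ := μ) (x₀ := (0 : ℝ))
    (F := fun c ω => X ω * Real.exp (-(u - c * X ω) ^ 2 / 2))
    (F' := fun c ω => X ω ^ 2 * ((u - c * X ω) * Real.exp (-(u - c * X ω) ^ 2 / 2)))
    (bound := fun ω => X ω ^ 2) (s := Set.univ) univ_mem
    (Eventually.of_forall fun c => by fun_prop) hint (by fun_prop)
    (ae_of_all _ fun ω c _ => hbound ω c) hX.integrable_sq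
    (ae_of_all _ fun ω c _ => hderiv ω c)).2
  simp only [zero_mul, sub_zero, integral_mul_const] at h
  exact h

lemma tendsto_integral_exp_neg_sq [IsProbabilityMeasure μ] (hX : AEMeasurable X μ) (u : ℝ) :
    Tendsto (fun c : ℝ => ∫ ω, Real.exp (-(u - c * X ω) ^ 2 / 2) ∂μ) (𝓝 0)
      (𝓝 (Real.exp (-u ^ 2 / 2))) := by
  have h := (continuous_of_dominated (μ := μ) (F := fun (c : ℝ) ω =>
    Real.exp (-(u - c * X ω) ^ 2 / 2)) (bound := fun _ => 1) (fun c => by fun_prop)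
    (fun c => ae_of_all _ fun ω => by
      rw [Real.norm_of_nonneg (Real.exp_pos _).le]
      exact exp_neg_sq_div_two_le_one _) (integrable_const _)
    (ae_of_all _ fun ω => by fun_prop)).tendsto 0
  simpa using h

lemma tendsto_gaussian_ratio_div_sq [IsProbabilityMeasure μ] (hX : MemLp X 2 μ)
    (hX0 : ∫ ω, X ω ∂μ = 0) (hX2 : ∫ ω, X ω ^ 2 ∂μ ≠ 0) (u : ℝ) :
    Tendsto (fun c : ℝ => (∫ ω, c * X ω * Real.exp (-(u - c * X ω) ^ 2 / 2) ∂μ) /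
      (∫ ω, Real.exp (-(u - c * X ω) ^ 2 / 2) ∂μ) / (c ^ 2 * ∫ ω, X ω ^ 2 ∂μ))
      (𝓝[≠] 0) (𝓝 u) := by
  have h1 := (hasDerivAt_integral_mul_exp_neg_sq hX u).tendsto_slope
  have h2 := (tendsto_integral_exp_neg_sq hX.aestronglyMeasurable.aemeasurable u).mono_left
    (nhdsWithin_le_nhds (s := {0}ᶜ))
  have h3 := (h1.div h2 (Real.exp_pos _).ne').div_const (∫ ω, X ω ^ 2 ∂μ)
  have hlim : (∫ ω, X ω ^ 2 ∂μ) * (u * Real.exp (-u ^ 2 / 2)) / Real.exp (-u ^ 2 / 2) /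
      (∫ ω, X ω ^ 2 ∂μ) = u := by
    have := (Real.exp_pos (-u ^ 2 / 2)).ne'
    field_simp
  rw [hlim] at h3
  refine h3.congr' ?_
  filter_upwards [self_mem_nhdsWithin] with c hc
  have hc' : c ≠ 0 := hc
  simp only [Pi.div_apply, slope_def_field, zero_mul, sub_zero, integral_mul_const, hX0, mul_assoc,
    integral_const_mul]
  generalize ∫ ω, X ω * Real.exp (-(u - c * X ω) ^ 2 / 2) ∂μ = I
  field_simp

/-- The Gaussian normalizing constant cancels, so only the ratio `s / σ` matters. -/
lemma gaussianEstimator_map_scale (hX : AEMeasurable X μ) {s σ : ℝ} {v : NNReal} (hσ : 0 < σ)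
    (hv : (v : ℝ) = σ ^ 2) (u : ℝ) :
    gaussianEstimator (μ.map fun ω => s * X ω) v (σ * u) / σ =
      (∫ ω, s / σ * X ω * Real.exp (-(u - s / σ * X ω) ^ 2 / 2) ∂μ) /
        ∫ ω, Real.exp (-(u - s / σ * X ω) ^ 2 / 2) ∂μ := by
  have hsX : AEMeasurable (fun ω => s * X ω) μ := hX.const_mul s
  have hpdf : ∀ ω, gaussianPDFReal (s * X ω) v (σ * u) =
      (√(2 * Real.pi * v))⁻¹ * Real.exp (-(u - s / σ * X ω) ^ 2 / 2) := fun ω => by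
    rw [gaussianPDFReal, hv]
    congr 2
    field_simp
  have hC : (√(2 * Real.pi * v))⁻¹ ≠ 0 := by
    have := Real.pi_pos
    rw [hv]
    positivity
  have hnum : ∫ ω, s * X ω * gaussianPDFReal (s * X ω) v (σ * u) ∂μ = (√(2 * Real.pi * v))⁻¹ *
      (σ * ∫ ω, s / σ * X ω * Real.exp (-(u - s / σ * X ω) ^ 2 / 2) ∂μ) := by
    rw [← integral_const_mul, ← integral_const_mul]
    refine integral_congr_ae (ae_of_all _ fun ω => ?_)
    dsimp only
    rw [hpdf]
    field_simp
  rw [gaussianEstimator, integral_map hsX (by exact (measurable_id.mul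
      (measurable_gaussianPDFReal_mean v _)).aestronglyMeasurable), integral_map hsX
      (measurable_gaussianPDFReal_mean v _).aestronglyMeasurable, hnum]
  simp_rw [hpdf]
  rw [integral_const_mul, mul_div_mul_left _ _ hC, mul_div_assoc, mul_div_cancel_left₀ _ hσ.ne']

lemma integral_sq_of_hasLaw_gaussianReal {v : NNReal} (hZ : HasLaw Z (gaussianReal 0 v) μ) :
    ∫ ω, Z ω ^ 2 ∂μ = v := by
  have h := variance_fun_id_gaussianReal (μ := 0) (v := v)
  rw [variance_of_integral_eq_zero (by fun_prop) integral_id_gaussianReal] at h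
  rw [← h, ← hZ.map_eq, integral_map hZ.aemeasurable (by fun_prop)]

lemma snr_const_mul (s t : ℝ) : snr μ (fun ω => s * X ω) (fun ω => t * Z ω) =
    (s ^ 2 * ∫ ω, X ω ^ 2 ∂μ) / (t ^ 2 * ∫ ω, Z ω ^ 2 ∂μ) := by
  simp only [snr, mul_pow, integral_const_mul]

lemma snr_symm (S N : Ω → ℝ) : snr μ N S = (snr μ S N)⁻¹ := by
  simp only [snr, inv_div]

lemma rms_ne_zero_of_snr_ne_zero {S N : Ω → ℝ} (h : snr μ S N ≠ 0) : rms μ N ≠ 0 := fun h0 => by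
  rw [rms, Real.sqrt_eq_zero (integral_nonneg fun _ => sq_nonneg _)] at h0
  simp [snr, h0] at h

/-- The variance of `t * Z` when `Z` has variance `w`. -/
def scaledVar (t : ℝ) (w : NNReal) : NNReal := .mk (t ^ 2) (sq_nonneg t) * w

lemma coe_scaledVar (t : ℝ) (w : NNReal) : (scaledVar t w : ℝ) = t ^ 2 * w := rfl

variable {w : NNReal}

lemma isContinuousMSEEstimator_scaled [IsProbabilityMeasure μ] (hX : MemLp X 2 μ)
    (hXZ : IndepFun X Z μ) (hZ : HasLaw Z (gaussianReal 0 w) μ) {s t : ℝ}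
    (hpos : 0 < snr μ (fun ω => s * X ω) (fun ω => t * Z ω)) :
    IsContinuousMSEEstimator μ (fun ω => s * X ω) (fun ω => s * X ω + t * Z ω)
      (gaussianEstimator (μ.map fun ω => s * X ω) (scaledVar t w)) := by
  rw [snr_const_mul, integral_sq_of_hasLaw_gaussianReal hZ, ← coe_scaledVar] at hpos
  refine isContinuousMSEEstimator_gaussianEstimator (hX.const_mul s)
    (hXZ.comp (measurable_const_mul s) (measurable_const_mul t)) ?_ fun h => ?_
  · simpa [scaledVar] using gaussianReal_const_mul hZ t
  · simp [h] at hpos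

/-- The filter is arbitrary so that both `γ → 0⁺` and, with the roles exchanged, `γ → ∞` are
covered. -/
lemma tendsto_gaussianEstimator_scaled [IsProbabilityMeasure μ] (hX : MemLp X 2 μ)
    (hX0 : ∫ ω, X ω ∂μ = 0) (hZ : HasLaw Z (gaussianReal 0 w) μ) {s t : ℝ → ℝ} {l : Filter ℝ}
    (hsnr : Tendsto (fun γ => snr μ (fun ω => s γ * X ω) (fun ω => t γ * Z ω)) l (𝓝[>] 0))
    (u : ℝ) :
    Tendsto (fun γ => gaussianEstimator (μ.map fun ω => s γ * X ω) (scaledVar (t γ) w)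
        (rms μ (fun ω => t γ * Z ω) * u) / rms μ (fun ω => t γ * Z ω) /
        snr μ (fun ω => s γ * X ω) (fun ω => t γ * Z ω)) l (𝓝 u) := by
  rcases l.eq_or_neBot with rfl | hl
  · exact tendsto_bot
  have hpos : ∀ᶠ γ in l, 0 < snr μ (fun ω => s γ * X ω) (fun ω => t γ * Z ω) :=
    hsnr.eventually self_mem_nhdsWithin
  have hrms : ∀ γ, rms μ (fun ω => t γ * Z ω) ^ 2 = t γ ^ 2 * w := fun γ => by
    rw [rms, Real.sq_sqrt (integral_nonneg fun _ => sq_nonneg _)]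
    simp only [mul_pow, integral_const_mul, integral_sq_of_hasLaw_gaussianReal hZ]
  have hsnr_eq : ∀ γ, snr μ (fun ω => s γ * X ω) (fun ω => t γ * Z ω) =
      (s γ / rms μ (fun ω => t γ * Z ω)) ^ 2 * ∫ ω, X ω ^ 2 ∂μ := fun γ => by
    rw [snr_const_mul, integral_sq_of_hasLaw_gaussianReal hZ, div_pow, hrms]
    ring
  have hX2 : ∫ ω, X ω ^ 2 ∂μ ≠ 0 := fun h => by
    obtain ⟨γ, hγ⟩ := hpos.exists
    simp [hsnr_eq, h] at hγ
  -- The sign of `s γ` is free, so only `|c| → 0` is available, hence the two-sided punctured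
  -- neighbourhood.
  have hc : Tendsto (fun γ => s γ / rms μ (fun ω => t γ * Z ω)) l (𝓝[≠] 0) := by
    refine tendsto_nhdsWithin_iff.2 ⟨?_, ?_⟩
    · have h := (tendsto_nhds_of_tendsto_nhdsWithin hsnr).div_const (∫ ω, X ω ^ 2 ∂μ)
      simp only [hsnr_eq, mul_div_cancel_right₀ _ hX2, zero_div] at h
      have h' := h.sqrt
      simp only [Real.sqrt_sq_eq_abs, Real.sqrt_zero] at h'
      exact (tendsto_zero_iff_abs_tendsto_zero _).2 h'
    · filter_upwards [hpos] with γ hγ h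
      have h0 : s γ / rms μ (fun ω => t γ * Z ω) = 0 := h
      rw [hsnr_eq, h0] at hγ
      simp at hγ
  refine ((tendsto_gaussian_ratio_div_sq hX hX0 hX2 u).comp hc).congr' ?_
  filter_upwards [hpos] with γ hγ
  have hσ : 0 < rms μ (fun ω => t γ * Z ω) := by
    refine lt_of_le_of_ne (Real.sqrt_nonneg _) fun h => ?_
    rw [hsnr_eq, ← h] at hγ
    simp at hγ
  rw [gaussianEstimator_map_scale hX.aestronglyMeasurable.aemeasurable hσ
    ((coe_scaledVar _ _).trans (hrms γ).symm), hsnr_eq]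
  rfl

end SmallScale

theorem theorem5 {Ω : Type*} [MeasurableSpace Ω] (μ : Measure Ω) [IsProbabilityMeasure μ]
    (X Z : Ω → ℝ) (hX : MemLp X 2 μ) (hZ : MemLp Z 2 μ)
    (hX0 : ∫ ω, X ω ∂μ = 0) (hZ0 : ∫ ω, Z ω ∂μ = 0) (hXZ : IndepFun X Z μ)
    (s t : ℝ → ℝ)
    (hst : ∀ γ : ℝ, 0 < γ → snr μ (fun ω => s γ * X ω) (fun ω => t γ * Z ω) = γ) :
    ((∃ v : NNReal, HasLaw Z (gaussianReal 0 v) μ) →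
      ∃ h : ℝ → ℝ → ℝ,
        (∀ γ : ℝ, 0 < γ →
          IsContinuousMSEEstimator μ (fun ω => s γ * X ω)
            (fun ω => s γ * X ω + t γ * Z ω) (h γ)) ∧
        AsymptoticallyLinear (𝓝[>] 0) (fun γ => rms μ (fun ω => t γ * Z ω)) h) ∧
    ((∃ v : NNReal, HasLaw X (gaussianReal 0 v) μ) →
      ∃ h : ℝ → ℝ → ℝ,
        (∀ γ : ℝ, 0 < γ →
          IsContinuousMSEEstimator μ (fun ω => s γ * X ω)
            (fun ω => s γ * X ω + t γ * Z ω) (h γ)) ∧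
        AsymptoticallyLinear atTop (fun γ => rms μ (fun ω => s γ * X ω)) h ∧
        ∀ u : ℝ, Tendsto
          (fun γ => γ * (nonlinPart γ (h γ) (rms μ (fun ω => s γ * X ω) * u) /
            rms μ (fun ω => s γ * X ω))) atTop (𝓝 0)) := by
  constructor
  · rintro ⟨w, hw⟩
    refine ⟨fun γ => gaussianEstimator (μ.map fun ω => s γ * X ω) (scaledVar (t γ) w),
      fun γ hγ => isContinuousMSEEstimator_scaled hX hXZ hw (by rwa [hst γ hγ]), fun u => ?_⟩
    have hsnr : (fun γ => snr μ (fun ω => s γ * X ω) (fun ω => t γ * Z ω)) =ᶠ[𝓝[>] 0] id := by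
      filter_upwards [self_mem_nhdsWithin] with γ hγ using hst γ hγ
    have h := tendsto_gaussianEstimator_scaled hX hX0 hw (tendsto_id.congr' hsnr.symm) u
    have h1 : Tendsto (fun γ : ℝ => γ + 1) (𝓝[>] 0) (𝓝 1) :=
      ((continuous_id.add continuous_const).tendsto' (0 : ℝ) 1 (by simp)).mono_left
        nhdsWithin_le_nhds
    have h2 := (h1.mul h).sub_const u
    rw [one_mul, sub_self] at h2
    refine h2.congr' ?_
    filter_upwards [self_mem_nhdsWithin] with γ hγ
    have hγ' : 0 < γ := hγ
    have hσ := rms_ne_zero_of_snr_ne_zero (μ := μ) (S := fun ω => s γ * X ω)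
      (N := fun ω => t γ * Z ω) (by rw [hst γ hγ']; exact hγ'.ne')
    rw [hst γ hγ', nonlinPart, linCoeff]
    field_simp
  · rintro ⟨w, hw⟩
    have hsnr : ∀ γ, 0 < γ → snr μ (fun ω => t γ * Z ω) (fun ω => s γ * X ω) = γ⁻¹ :=
      fun γ hγ => by rw [snr_symm, hst γ hγ]
    have hev : (fun γ => snr μ (fun ω => t γ * Z ω) (fun ω => s γ * X ω)) =ᶠ[atTop] fun γ => γ⁻¹ := by
      filter_upwards [eventually_gt_atTop 0] with γ hγ using hsnr γ hγ
    have key : ∀ u : ℝ, Tendsto (fun γ => γ * (nonlinPart γ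
        (fun y => y - gaussianEstimator (μ.map fun ω => t γ * Z ω) (scaledVar (s γ) w) y)
        (rms μ (fun ω => s γ * X ω) * u) / rms μ (fun ω => s γ * X ω))) atTop (𝓝 0) := fun u => by
      have h := tendsto_gaussianEstimator_scaled hZ hZ0 hw
        (tendsto_inv_atTop_nhdsGT_zero.congr' hev.symm) u
      have h1 : Tendsto (fun γ : ℝ => 1 + γ⁻¹) atTop (𝓝 1) := by
        simpa using tendsto_inv_atTop_zero.const_add (1 : ℝ)
      have h2 := (h1.mul h).const_sub u
      rw [one_mul, sub_self] at h2
      refine h2.congr' ?_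
      filter_upwards [eventually_gt_atTop 0] with γ hγ
      have hσ := rms_ne_zero_of_snr_ne_zero (μ := μ) (S := fun ω => t γ * Z ω)
        (N := fun ω => s γ * X ω) (by rw [hsnr γ hγ]; exact (inv_pos.2 hγ).ne')
      rw [hsnr γ hγ, nonlinPart, linCoeff]
      field_simp
      ring
    refine ⟨fun γ y => y - gaussianEstimator (μ.map fun ω => t γ * Z ω) (scaledVar (s γ) w) y,
      fun γ hγ => ?_, fun u => ?_, key⟩
    · have h := (isContinuousMSEEstimator_scaled hZ hXZ.symm hw
        (by rw [hsnr γ hγ]; exact inv_pos.2 hγ)).sub_of_add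
      simpa only [add_comm] using h
    -- Plain asymptotic linearity is the stronger limit multiplied by `γ⁻¹`.
    · have h := tendsto_inv_atTop_zero.mul (key u)
      rw [zero_mul] at h
      refine h.congr' ?_
      filter_upwards [eventually_gt_atTop 0] with γ hγ
      rw [inv_mul_cancel_left₀ hγ.ne']
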